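/- Let $G=(V,E)$ be a finite undirected graph with $n=|V|\ge 2$ nodes and a self-loop at every node, let $N(v)=\{u:\{u,v\}\in E\}$ (so $v\in N(v)$) and $d_v=|N(v)|$, and let $M$ be the transition matrix of the random walk, $M(v,u)=1/d_v$ if $u\in N(v)$ and $M(v,u)=0$ otherwise. Let $|E|=\frac12\sum_{v}d_v$ be the number of edges, where a self-loop counts as one half (it adds one to the degree of its node). Two players $X$ and $Y$ with the same budget $B>0$ simultaneously choose allocations $x,y\in\mathbb{R}_{\ge 0}^V$ with $\sum_v x_v=\sum_v y_v=B$. Node $v$ starts with opinion $f_0(v)=1$ if $x_v>y_v$, with $f_0(v)=-1$ if $x_v<y_v$, and with $f_0(v)=\pm1$ by a fair coin flip if $x_v=y_v$. At each time $t\ge1$ every node $v$ picks, independently, a uniformly random $u\in N(v)$ and sets $f_t(v)=f_{t-1}(u)$ (the voter model). In the game with target time $\tau\in\{0,1,2,\dots\}$, $X$ maximizes and $Y$ minimizes $\mathbb{E}\big[\sum_{v}f_\tau(v)\big]$. A mixed strategy is a probability distribution on allocations. **(1)** For every $\tau$ there is a probability distribution $F_\tau^*$ on $\Delta_B=\{x\in\mathbb{R}_{\ge0}^V:\sum_v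 x_v=B\}$ such that each coordinate $x_i$ is uniformly distributed on $\big[0,\,2B\cdot\frac1n\sum_{j}M^\tau(j,i)\big]$, and for every such $F_\tau^*$ the pair $(F_\tau^*,F_\tau^*)$ is a Nash equilibrium of the game with target time $\tau$. **(2)** If moreover $G$ is connected, then the long-term payoff $\lim_{\tau\to\infty}\mathbb{E}\big[\sum_v f_\tau(v)\big]$ exists for all allocations $x,y$; there is a probability distribution $F_\infty^*$ on $\Delta_B$ such that each coordinate $x_i$ is uniformly distributed on $\big[0,\,B\,d_i/|E|\big]$, and for every such $F_\infty^*$ the pair $(F_\infty^*,F_\infty^*)$ is a Nash equilibrium of the game with the long-term payoff. Both (1) and (2) remain true if the players are allowed to spend less than their budget, i.e. if the allocations are only required to satisfy $\sum_v x_v\le B$ and $\sum_v y_v\le B$. -/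

import Mathlib

open MeasureTheory Filter Topology

namespace VoterGame

noncomputable section

/-! ### The social network

The network is an undirected graph with a self-loop at every node.  It is given by the simple
graph `G` of its non-loop edges; the loops are added in the neighbourhoods below. -/

section Graph

variable {V : Type*} [Fintype V] [DecidableEq V] (G : SimpleGraph V) [DecidableRel G.Adj]

/-- The neighbourhood `N(v) = {u | {u, v} ∈ E}`; it contains `v`, because of the self-loop. -/
def nbhd (v : V) : Finset V := insert v (G.neighborFinset v)

theorem nbhd_nonempty (v : V) : (nbhd G v).Nonempty := Finset.insert_nonempty _ _

/-- The degree `d_v = |N(v)|`. -/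
def deg (v : V) : ℕ := (nbhd G v).card

/-- The total number `|E|` of edges, where a self-loop, which adds one (and not two) to the degree
`|N(v)|` of its node, counts as half an edge, so that `2|E| = ∑ v, d_v` (`sum_deg`). -/
def numEdges : ℝ := (G.edgeFinset.card : ℝ) + (Fintype.card V : ℝ) / 2

theorem sum_deg : ∑ v, (deg G v : ℝ) = 2 * numEdges G := by
  have h : ∀ v, (deg G v : ℝ) = (G.degree v : ℝ) + 1 := by
    intro v
    simp [deg, nbhd]
  have h2 : ∑ v, (G.degree v : ℝ) = 2 * (G.edgeFinset.card : ℝ) := by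
    exact_mod_cast G.sum_degrees_eq_twice_card_edges
  simp only [h, Finset.sum_add_distrib, h2, numEdges]
  simp
  ring

/-- The normalized transition matrix of the random walk: `M(v,u) = 1/|N(v)|` if `u ∈ N(v)`, and
`0` otherwise. -/
def transitionMatrix : Matrix V V ℝ :=
  Matrix.of fun v u => if u ∈ nbhd G v then 1 / (deg G v : ℝ) else 0

/-! ### The voter model

An opinion is an element of `ℤˣ = {1, -1}`: `1` is for player `X`, `-1` is for player `Y`. -/

/-- The law of `f₀`, given the allocations `x` of player `X` and `y` of player `Y`: node `v` has
opinion `1` if `x v > y v`, opinion `-1` if `x v < y v`, and flips a fair coin if `x v = y v`. -/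
def initialLaw (x y : V → ℝ) : PMF (V → ℤˣ) :=
  (PMF.uniformOfFintype (V → ℤˣ)).map fun r v =>
    if y v < x v then 1 else if x v < y v then -1 else r v

/-- One step of the voter model: each node `v` picks, uniformly at random and independently of the
other nodes, a neighbour `c v ∈ N(v)` and adopts its opinion. -/
def voterStep (f : V → ℤˣ) : PMF (V → ℤˣ) :=
  (PMF.uniformOfFinset (Fintype.piFinset (nbhd G))
    (Fintype.piFinset_nonempty.2 (nbhd_nonempty G))).map fun c v => f (c v)

/-- The law of the opinions `f_t` at time `t`. -/
def voterLaw (x y : V → ℝ) : ℕ → PMF (V → ℤˣ)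
  | 0 => initialLaw x y
  | t + 1 => (voterLaw x y t).bind (voterStep G)

/-- The objective `𝔼[∑ v, f_τ(v)]` of player `X` at target time `τ`; that of player `Y` is the
opposite. -/
def payoff (τ : ℕ) (x y : V → ℝ) : ℝ :=
  ∑ f : V → ℤˣ, (voterLaw G x y τ f).toReal * ∑ v, ((f v : ℤ) : ℝ)

/-- The long-term objective `lim_{τ → ∞} 𝔼[∑ v, f_τ(v)]` (meaningful when the limit exists). -/
def longTermPayoff (x y : V → ℝ) : ℝ := limUnder atTop fun τ => payoff G τ x y

end Graph

/-! ### Allocations, mixed strategies and equilibria -/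

section Game

variable {V : Type*} [Fintype V]

/-- The allocations that spend the whole budget `B`: the simplex `Δ^{n-1}`, scaled by `B`. -/
def simplexAlloc (B : ℝ) : Set (V → ℝ) := {x | (∀ v, 0 ≤ x v) ∧ ∑ v, x v = B}

/-- The allocations that satisfy the budget constraint `∑ v, x v ≤ B`. -/
def budgetAlloc (B : ℝ) : Set (V → ℝ) := {x | (∀ v, 0 ≤ x v) ∧ ∑ v, x v ≤ B}

/-- A mixed strategy on a set `A` of pure strategies: a probability law carried by `A`. -/
def IsMixedStrategy (A : Set (V → ℝ)) (F : Measure (V → ℝ)) : Prop :=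
  IsProbabilityMeasure F ∧ ∀ᵐ x ∂F, x ∈ A

/-- The expected payoff of the mixed strategy `F` of player `X` against `H` of player `Y`. -/
def mixedPayoff (g : (V → ℝ) → (V → ℝ) → ℝ) (F H : Measure (V → ℝ)) : ℝ :=
  ∫ x, ∫ y, g x y ∂H ∂F

/-- `(F, H)` is a Nash equilibrium, in mixed strategies on `A`, of the two-player zero-sum game in
which player `X` maximizes `g` and player `Y` maximizes `-g`. -/
structure IsNashEquilibrium (A : Set (V → ℝ)) (g : (V → ℝ) → (V → ℝ) → ℝ)
    (F H : Measure (V → ℝ)) : Prop where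
  mixed_left : IsMixedStrategy A F
  mixed_right : IsMixedStrategy A H
  best_left : ∀ F', IsMixedStrategy A F' → mixedPayoff g F' H ≤ mixedPayoff g F H
  best_right : ∀ H', IsMixedStrategy A H' → -mixedPayoff g F H' ≤ -mixedPayoff g F H

/-- `F` is a law on the simplex of the allocations of the whole budget `B` such that, for each
node `i`, the coordinate `x i` is uniformly distributed on `[0, L i]`. -/
def HasUniformCoordinates (B : ℝ) (L : V → ℝ) (F : Measure (V → ℝ)) : Prop :=
  IsMixedStrategy (simplexAlloc B) F ∧
    ∀ i, pdf.IsUniform (fun x : V → ℝ => x i) (Set.Icc 0 (L i)) F volume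

/-- The symmetric game with payoff `g` and budget `B` for both players is solved by the laws on
the simplex with uniform coordinates on `[0, L i]`: there is such a law, and for each such law `F`
the pair `(F, F)` is a Nash equilibrium, both when the players have to spend the whole budget and
when they may spend less. -/
def SolvedByUniform (g : (V → ℝ) → (V → ℝ) → ℝ) (B : ℝ) (L : V → ℝ) : Prop :=
  (∃ F, HasUniformCoordinates B L F) ∧
    ∀ F, HasUniformCoordinates B L F →
      IsNashEquilibrium (simplexAlloc B) g F F ∧ IsNashEquilibrium (budgetAlloc B) g F F

end Game

end

end VoterGame

/-!
Expected opinions evolve linearly, so the payoff at time `τ` is `∑ i, p i * sign (x i - y i)`,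
where the influence `p i` is the `i`-th column sum of `M ^ τ` (`payoff_eq_blotto`): the voter model
reduces to a Colonel Blotto game with values `p i > 0` and total value `n`.

In such a game, let `L i = 2 B p i / ∑ p`.  Against a law whose `i`-th coordinate is uniform on
`[0, L i]`, the amount `r` wins node `i` with probability at most `r / L i`, so it earns there at
most `p i (2 r / L i - 1)`.  This bound is affine in `r` with a slope that does not depend on `i`;
hence every allocation of at most `B` earns at most `0` (`integral_blotto_nonpos`).  As the game is
antisymmetric, both players using such a law is an equilibrium, whatever the dependence between the
coordinates (`isNashEquilibrium_blotto`).

It remains to couple uniform variables on `[0, L i]` so that their sum is constantly `B`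
(`exists_hasUniformCoordinates`).  If no `L i` exceeds the sum of the others, the `L i` are the side
lengths of a closed polygon in the plane, `∑ i, L i * u i = 0` with unit vectors `u i`.  By
Archimedes' hat-box theorem the projection `Z` to the plane of a uniform point of the sphere has all
its one-dimensional projections uniform on `[-1, 1]`, and `L i / 2 * (1 + Re (u i * Z))` is the
required coupling.  The polygon inequality says that no node has more than half of the total
influence (`two_mul_influence_le`): a node with a neighbour receives from each node at most half of
the influence of that node, and an isolated node has influence `1 ≤ n / 2`.

On a connected graph some power of `M` is positive, because of the self-loops, so that power
contracts row vectors of total mass zero (`tendsto_sum_abs_vecMul_pow`), and the influences converge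
to multiples of the degrees, the stationary vector of the walk.  The long-term game is thus again a
Blotto game, and the bound on the influences passes to the limit.
-/

namespace VoterGame

/-! ### Expectations under finite probability mass functions -/

section PMFExpectation

variable {α β : Type*} [Fintype α] [Fintype β]

/-- The expectation of `φ` under a probability mass function on a finite type, as a finite sum. -/
noncomputable def expect (p : PMF α) (φ : α → ℝ) : ℝ := ∑ a, (p a).toReal * φ a

theorem expect_sum {ι : Type*} (s : Finset ι) (p : PMF α) (φ : ι → α → ℝ) :
    expect p (fun a => ∑ i ∈ s, φ i a) = ∑ i ∈ s, expect p (φ i) := by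
  simp only [expect, Finset.mul_sum]
  exact Finset.sum_comm

theorem expect_const_mul (p : PMF α) (c : ℝ) (φ : α → ℝ) :
    expect p (fun a => c * φ a) = c * expect p φ := by
  simp only [expect, Finset.mul_sum]
  exact Finset.sum_congr rfl fun a _ => by ring

theorem expect_bind (p : PMF α) (q : α → PMF β) (φ : β → ℝ) :
    expect (p.bind q) φ = expect p fun a => expect (q a) φ := by
  have h : ∀ b, (p.bind q b).toReal = ∑ a, (p a).toReal * (q a b).toReal := by
    intro b
    rw [PMF.bind_apply, tsum_fintype, ENNReal.toReal_sum]
    · simp only [ENNReal.toReal_mul]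
    · exact fun a _ => ENNReal.mul_ne_top (p.apply_ne_top a) ((q a).apply_ne_top b)
  simp only [expect, h, Finset.sum_mul, Finset.mul_sum]
  rw [Finset.sum_comm]
  exact Finset.sum_congr rfl fun a _ => Finset.sum_congr rfl fun b _ => by ring

theorem expect_map (p : PMF α) (f : α → β) (φ : β → ℝ) :
    expect (p.map f) φ = expect p (φ ∘ f) := by
  classical
  rw [PMF.map, expect_bind]
  congr 1
  funext a
  rw [expect, Finset.sum_eq_single (f a)]
  · simp
  · intro b _ hb
    simp [PMF.pure_apply, hb]
  · simp

theorem expect_uniformOfFinset (s : Finset α) (hs : s.Nonempty) (φ : α → ℝ) :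
    expect (PMF.uniformOfFinset s hs) φ = (s.card : ℝ)⁻¹ * ∑ a ∈ s, φ a := by
  classical
  simp only [expect, PMF.uniformOfFinset_apply]
  rw [Finset.mul_sum, ← Finset.sum_subset (Finset.subset_univ s)]
  · exact Finset.sum_congr rfl fun a ha => by simp [ha]
  · intro a _ ha
    simp [ha]

/-- Under the uniform law on a finite box, each coordinate is uniform on its side. -/
theorem expect_uniformOfFinset_piFinset {ι : Type*} [Fintype ι] [DecidableEq ι]
    (t : ι → Finset α) (ht : ∀ i, (t i).Nonempty) (v : ι) (φ : α → ℝ) :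
    expect (PMF.uniformOfFinset (Fintype.piFinset t) (Fintype.piFinset_nonempty.2 ht))
      (fun c => φ (c v)) = ((t v).card : ℝ)⁻¹ * ∑ u ∈ t v, φ u := by
  -- expand a product over the coordinates in which only the factor at `v` is not constant
  have h := Finset.prod_univ_sum t (fun i u => if i = v then φ u else 1)
  have h1 : ∀ c : ι → α, (∏ i, if i = v then φ (c i) else 1) = φ (c v) := fun c => by
    rw [Finset.prod_ite_eq' Finset.univ v (fun i => φ (c i))]; simp
  simp only [h1] at h
  rw [expect_uniformOfFinset, ← h, Fintype.card_piFinset,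
    ← Finset.mul_prod_erase Finset.univ (fun i => (t i).card) (Finset.mem_univ v),
    ← Finset.mul_prod_erase Finset.univ (fun i => ∑ j ∈ t i, if i = v then φ j else 1)
      (Finset.mem_univ v)]
  have h2 : ∏ i ∈ Finset.univ.erase v, ∑ u ∈ t i, (if i = v then φ u else 1) =
      ∏ i ∈ Finset.univ.erase v, ((t i).card : ℝ) := by
    refine Finset.prod_congr rfl fun i hi => ?_
    simp [Finset.ne_of_mem_erase hi]
  have h3 : (∏ i ∈ Finset.univ.erase v, ((t i).card : ℝ)) ≠ 0 :=
    Finset.prod_ne_zero_iff.2 fun i _ => by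
      exact_mod_cast (Finset.card_pos.2 (ht i)).ne'
  have h4 : ((t v).card : ℝ) ≠ 0 := by exact_mod_cast (Finset.card_pos.2 (ht v)).ne'
  rw [h2]
  push_cast
  simp only [if_true]
  field_simp

end PMFExpectation

/-! ### Expected opinions in the voter model -/

section Voter

variable {V : Type*} [Fintype V] [DecidableEq V] (G : SimpleGraph V) [DecidableRel G.Adj]

theorem expect_initialLaw (x y : V → ℝ) (v : V) :
    expect (initialLaw x y) (fun f => ((f v : ℤ) : ℝ)) = Real.sign (x v - y v) := by
  have key := expect_uniformOfFinset_piFinset (fun _ : V => (Finset.univ : Finset ℤˣ))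
    (fun _ => Finset.univ_nonempty) v
    (fun r => (((if y v < x v then 1 else if x v < y v then -1 else r : ℤˣ) : ℤ) : ℝ))
  have hu : (PMF.uniformOfFintype (V → ℤˣ)) =
      PMF.uniformOfFinset (Fintype.piFinset fun _ : V => (Finset.univ : Finset ℤˣ))
        (Fintype.piFinset_nonempty.2 fun _ => Finset.univ_nonempty) := by
    simp only [Fintype.piFinset_univ]
    rfl
  rw [initialLaw, expect_map, hu]
  refine key.trans ?_
  have hU : (Finset.univ : Finset ℤˣ) = {1, -1} := rfl
  have hne : (1 : ℤˣ) ∉ ({-1} : Finset ℤˣ) := by decide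
  rw [hU, Finset.sum_insert hne, Finset.sum_singleton, Finset.card_insert_of_notMem hne]
  rcases lt_trichotomy (x v) (y v) with h | h | h
  · rw [Real.sign_of_neg (sub_neg.2 h)]
    simp [h, h.not_gt]
    norm_num
  · simp [h]
  · rw [Real.sign_of_pos (sub_pos.2 h)]
    simp [h]
    norm_num

theorem expect_voterStep (f : V → ℤˣ) (v : V) :
    expect (voterStep G f) (fun f' => ((f' v : ℤ) : ℝ)) =
      ∑ u, transitionMatrix G v u * ((f u : ℤ) : ℝ) := by
  rw [voterStep, expect_map]
  refine (expect_uniformOfFinset_piFinset (nbhd G) (nbhd_nonempty G) v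
    (fun u => ((f u : ℤ) : ℝ))).trans ?_
  simp only [transitionMatrix, Matrix.of_apply, ite_mul, zero_mul]
  rw [Finset.sum_ite_mem, Finset.univ_inter, Finset.mul_sum]
  simp [deg]

/-- The expected opinions evolve by the transition matrix of the random walk. -/
theorem expect_voterLaw (x y : V → ℝ) (τ : ℕ) (v : V) :
    expect (voterLaw G x y τ) (fun f => ((f v : ℤ) : ℝ)) =
      ∑ u, (transitionMatrix G ^ τ) v u * Real.sign (x u - y u) := by
  induction τ generalizing v with
  | zero => simp [voterLaw, expect_initialLaw, Matrix.one_apply]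
  | succ t ih =>
    simp only [voterLaw, expect_bind, expect_voterStep]
    rw [expect_sum]
    simp only [expect_const_mul, ih, pow_succ', Matrix.mul_apply, Finset.sum_mul, Finset.mul_sum]
    rw [Finset.sum_comm]
    exact Finset.sum_congr rfl fun _ _ => Finset.sum_congr rfl fun _ _ => by ring

/-- The influence of each node at time `τ`: the expected number of nodes whose opinion at time `τ`
is a copy of the initial opinion of `i`, which is the `i`-th column sum of `M ^ τ`. -/
noncomputable def influence (τ : ℕ) (i : V) : ℝ := ∑ j, (transitionMatrix G ^ τ) j i

end Voter

/-- The payoff of the first player in the zero-sum game in which the player with the larger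
allocation at node `i` wins `p i`, and ties are worth `0`. -/
noncomputable def blotto {V : Type*} [Fintype V] (p x y : V → ℝ) : ℝ :=
  ∑ i, p i * Real.sign (x i - y i)

theorem payoff_eq_blotto {V : Type*} [Fintype V] [DecidableEq V] (G : SimpleGraph V)
    [DecidableRel G.Adj] (τ : ℕ) : payoff G τ = blotto (influence G τ) := by
  funext x y
  change expect (voterLaw G x y τ) (fun f => ∑ v, ((f v : ℤ) : ℝ)) = _
  rw [expect_sum]
  simp only [expect_voterLaw, blotto, influence, Finset.sum_mul]
  exact Finset.sum_comm

/-! ### Convergence of powers of stochastic matrices -/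

section Contraction

open Matrix

variable {V : Type*} [Fintype V] [DecidableEq V]

/-- Doeblin's contraction: a stochastic matrix whose entries are at least `δ` contracts the
`ℓ¹` norm of row vectors of total mass zero by the factor `1 - n δ`. -/
theorem sum_abs_vecMul_le {P : Matrix V V ℝ} (hP : P ∈ rowStochastic ℝ V) {δ : ℝ}
    (hδ : ∀ i j, δ ≤ P i j) {v : V → ℝ} (hv : ∑ i, v i = 0) :
    ∑ i, |(v ᵥ* P) i| ≤ (1 - Fintype.card V * δ) * ∑ i, |v i| := by
  have h1 : ∀ i, (v ᵥ* P) i = ∑ j, v j * (P j i - δ) := by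
    intro i
    simp only [mul_sub, Finset.sum_sub_distrib, ← Finset.sum_mul, hv, zero_mul, sub_zero]
    rfl
  calc ∑ i, |(v ᵥ* P) i| ≤ ∑ i, ∑ j, |v j| * (P j i - δ) := by
        refine Finset.sum_le_sum fun i _ => ?_
        rw [h1]
        refine (Finset.abs_sum_le_sum_abs _ _).trans (Finset.sum_le_sum fun j _ => ?_)
        rw [abs_mul, abs_of_nonneg (sub_nonneg.2 (hδ j i))]
    _ = ∑ j, |v j| * (1 - Fintype.card V * δ) := by
        rw [Finset.sum_comm]
        refine Finset.sum_congr rfl fun j _ => ?_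
        rw [← Finset.mul_sum, Finset.sum_sub_distrib, sum_row_of_mem_rowStochastic hP]
        simp
    _ = _ := by rw [← Finset.sum_mul, mul_comm]

theorem sum_vecMul_of_mem_rowStochastic {P : Matrix V V ℝ} (hP : P ∈ rowStochastic ℝ V)
    (v : V → ℝ) : ∑ i, (v ᵥ* P) i = ∑ i, v i := by
  simp only [vecMul, dotProduct]
  rw [Finset.sum_comm]
  refine Finset.sum_congr rfl fun j _ => ?_
  rw [← Finset.mul_sum, sum_row_of_mem_rowStochastic hP, mul_one]

/-- If some power of a stochastic matrix is positive, then its powers annihilate, in the limit,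
every row vector of total mass zero. -/
theorem tendsto_sum_abs_vecMul_pow {P : Matrix V V ℝ} (hP : P ∈ rowStochastic ℝ V) {N : ℕ}
    (hN : ∀ i j, 0 < (P ^ N) i j) {v : V → ℝ} (hv : ∑ i, v i = 0) :
    Tendsto (fun t : ℕ => ∑ i, |(v ᵥ* P ^ t) i|) atTop (𝓝 0) := by
  rcases isEmpty_or_nonempty V with hV | hV
  · simp
  obtain ⟨p, hp⟩ := Finite.exists_min fun p : V × V => (P ^ N) p.1 p.2
  set δ := (P ^ N) p.1 p.2
  set a : ℕ → ℝ := fun t => ∑ i, |(v ᵥ* P ^ t) i|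
  have hs : ∀ t, ∑ i, (v ᵥ* P ^ t) i = 0 := fun t => by
    rw [sum_vecMul_of_mem_rowStochastic (pow_mem hP t), hv]
  have hanti : Antitone a := antitone_nat_of_succ_le fun t => by
    have h := sum_abs_vecMul_le (δ := 0) hP (fun _ _ => nonneg_of_mem_rowStochastic hP) (hs t)
    rw [vecMul_vecMul, ← pow_succ] at h
    simpa using h
  have hcontr : ∀ t, a (t + N) ≤ (1 - Fintype.card V * δ) * a t := fun t => by
    have h := sum_abs_vecMul_le (pow_mem hP N) (fun i j => hp (i, j)) (hs t)
    rwa [vecMul_vecMul, ← pow_add] at h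
  have ha0 : ∀ t, 0 ≤ a t := fun t => Finset.sum_nonneg fun i _ => abs_nonneg _
  -- the norms decrease to a limit `l`, and the contraction forces `l ≤ (1 - n δ) l`
  have hlim := tendsto_atTop_ciInf hanti ⟨0, by rintro _ ⟨t, rfl⟩; exact ha0 t⟩
  set l := ⨅ t, a t
  have hl0 : 0 ≤ l := ge_of_tendsto' hlim ha0
  have hl1 : l ≤ (1 - Fintype.card V * δ) * l :=
    le_of_tendsto_of_tendsto' (hlim.comp (tendsto_add_atTop_nat N)) (hlim.const_mul _) hcontr
  have hδ : 0 < Fintype.card V * δ := mul_pos (by exact_mod_cast Fintype.card_pos) (hN _ _)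
  have : l = 0 := by nlinarith
  rwa [this] at hlim

end Contraction

/-! ### Influences of the nodes -/

section Graph

open Matrix

variable {V : Type*} [Fintype V] [DecidableEq V] (G : SimpleGraph V) [DecidableRel G.Adj]

theorem mem_nbhd {u v : V} : u ∈ nbhd G v ↔ u = v ∨ G.Adj v u := by
  simp [nbhd]

theorem mem_nbhd_comm {u v : V} : u ∈ nbhd G v ↔ v ∈ nbhd G u := by
  rw [mem_nbhd, mem_nbhd, G.adj_comm, eq_comm]

theorem deg_pos (v : V) : 0 < deg G v := Finset.card_pos.2 (nbhd_nonempty G v)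

theorem transitionMatrix_apply (v u : V) :
    transitionMatrix G v u = if u ∈ nbhd G v then 1 / (deg G v : ℝ) else 0 := rfl

theorem transitionMatrix_nonneg (v u : V) : 0 ≤ transitionMatrix G v u := by
  rw [transitionMatrix_apply]
  split_ifs <;> positivity

theorem transitionMatrix_pos {v u : V} (h : u ∈ nbhd G v) : 0 < transitionMatrix G v u := by
  have := deg_pos G v
  rw [transitionMatrix_apply, if_pos h]
  positivity

theorem transitionMatrix_mem_rowStochastic : transitionMatrix G ∈ rowStochastic ℝ V := by
  rw [mem_rowStochastic_iff_sum]
  refine ⟨transitionMatrix_nonneg G, fun v => ?_⟩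
  have h : (deg G v : ℝ) ≠ 0 := by exact_mod_cast (deg_pos G v).ne'
  simp only [transitionMatrix_apply]
  rw [Finset.sum_ite_mem, Finset.univ_inter, Finset.sum_const, nsmul_eq_mul]
  exact mul_one_div_cancel h

/-- The random walk is reversible with respect to the degrees. -/
theorem deg_mul_transitionMatrix (v u : V) :
    (deg G v : ℝ) * transitionMatrix G v u = deg G u * transitionMatrix G u v := by
  have hv : (deg G v : ℝ) ≠ 0 := by exact_mod_cast (deg_pos G v).ne'
  have hu : (deg G u : ℝ) ≠ 0 := by exact_mod_cast (deg_pos G u).ne'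
  simp only [transitionMatrix_apply, mem_nbhd_comm G (u := u) (v := v)]
  split_ifs
  · rw [mul_one_div_cancel hv, mul_one_div_cancel hu]
  · simp

theorem deg_vecMul_transitionMatrix :
    (fun v => (deg G v : ℝ)) ᵥ* transitionMatrix G = fun v => (deg G v : ℝ) := by
  funext i
  simp only [vecMul, dotProduct, deg_mul_transitionMatrix G _ i]
  rw [← Finset.mul_sum, sum_row_of_mem_rowStochastic (transitionMatrix_mem_rowStochastic G),
    mul_one]

theorem deg_vecMul_transitionMatrix_pow (τ : ℕ) :
    (fun v => (deg G v : ℝ)) ᵥ* transitionMatrix G ^ τ = fun v => (deg G v : ℝ) := by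
  induction τ with
  | zero => simp
  | succ t ih => rw [pow_succ, ← vecMul_vecMul, ih, deg_vecMul_transitionMatrix]

theorem transitionMatrix_pow_nonneg (τ : ℕ) (v u : V) : 0 ≤ (transitionMatrix G ^ τ) v u :=
  nonneg_of_mem_rowStochastic (pow_mem (transitionMatrix_mem_rowStochastic G) τ)

theorem transitionMatrix_pow_succ_pos {τ : ℕ} {v u w : V} (hw : w ∈ nbhd G v)
    (h : 0 < (transitionMatrix G ^ τ) w u) : 0 < (transitionMatrix G ^ (τ + 1)) v u := by
  rw [pow_succ', mul_apply]
  exact (mul_pos (transitionMatrix_pos G hw) h).trans_le <|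
    Finset.single_le_sum (f := fun j => transitionMatrix G v j * (transitionMatrix G ^ τ) j u)
      (fun j _ => mul_nonneg (transitionMatrix_nonneg G v j) (transitionMatrix_pow_nonneg G τ j u))
      (Finset.mem_univ w)

theorem transitionMatrix_pow_pos_of_le {s t : ℕ} (hst : s ≤ t) {v u : V}
    (h : 0 < (transitionMatrix G ^ s) v u) : 0 < (transitionMatrix G ^ t) v u := by
  induction t, hst using Nat.le_induction with
  | base => exact h
  | succ t _ ih => exact transitionMatrix_pow_succ_pos G ((mem_nbhd G).2 (Or.inl rfl)) ih

theorem transitionMatrix_pow_length_pos {v u : V} (p : G.Walk v u) :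
    0 < (transitionMatrix G ^ p.length) v u := by
  induction p with
  | nil => simp
  | cons h p ih => exact transitionMatrix_pow_succ_pos G ((mem_nbhd G).2 (Or.inr h)) ih

theorem transitionMatrix_pow_card_pos (hG : G.Connected) (v u : V) :
    0 < (transitionMatrix G ^ Fintype.card V) v u := by
  obtain ⟨p, hp⟩ := (hG.preconnected v u).exists_isPath
  exact transitionMatrix_pow_pos_of_le G hp.length_lt.le (transitionMatrix_pow_length_pos G p)

theorem influence_eq_vecMul (τ : ℕ) : influence G τ = (fun _ => 1) ᵥ* transitionMatrix G ^ τ := by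
  funext i
  simp [influence, vecMul, dotProduct]

theorem influence_succ (τ : ℕ) (i : V) :
    influence G (τ + 1) i = ∑ j, influence G τ j * transitionMatrix G j i := by
  rw [influence_eq_vecMul, influence_eq_vecMul, pow_succ, ← vecMul_vecMul]
  rfl

theorem influence_pos (τ : ℕ) (i : V) : 0 < influence G τ i :=
  Finset.sum_pos' (fun j _ => transitionMatrix_pow_nonneg G τ j i)
    ⟨i, Finset.mem_univ i, transitionMatrix_pow_pos_of_le G (Nat.zero_le τ) (by simp)⟩

theorem sum_influence (τ : ℕ) : ∑ i, influence G τ i = Fintype.card V := by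
  rw [influence_eq_vecMul, sum_vecMul_of_mem_rowStochastic
    (pow_mem (transitionMatrix_mem_rowStochastic G) τ)]
  simp

theorem nbhd_eq_singleton {i : V} (hi : deg G i < 2) : nbhd G i = {i} := by
  symm
  refine Finset.eq_of_subset_of_card_le ?_
    (by rw [Finset.card_singleton]; exact Nat.le_of_lt_succ hi)
  simp [mem_nbhd]

/-- A node that is not isolated is imitated with probability at most `1/2`, because each of its
neighbours also has itself to imitate. -/
theorem transitionMatrix_le_half {i : V} (hi : 2 ≤ deg G i) (j : V) :
    transitionMatrix G j i ≤ 1 / 2 := by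
  rw [transitionMatrix_apply]
  split_ifs with h
  · have hj : 2 ≤ deg G j := by
      by_contra hlt
      have := nbhd_eq_singleton G (not_le.1 hlt)
      rw [this, Finset.mem_singleton] at h
      exact hlt (h ▸ hi)
    exact one_div_le_one_div_of_le two_pos (by exact_mod_cast hj)
  · norm_num

/-- No node has more than half of the total influence. -/
theorem two_mul_influence_le (hn : 2 ≤ Fintype.card V) (τ : ℕ) (i : V) :
    2 * influence G τ i ≤ Fintype.card V := by
  have hn' : (2 : ℝ) ≤ Fintype.card V := by exact_mod_cast hn
  rcases lt_or_ge (deg G i) 2 with hi | hi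
  · -- an isolated node keeps its opinion, and nobody copies it
    have hnb := nbhd_eq_singleton G hi
    have h1 : influence G τ i = 1 := by
      induction τ with
      | zero => simp [influence, Matrix.one_apply]
      | succ t ih =>
        rw [influence_succ, Finset.sum_eq_single i]
        · rw [ih, transitionMatrix_apply, deg, hnb]; simp
        · intro j _ hj
          have hij : i ∉ nbhd G j := by rw [mem_nbhd_comm, hnb]; simpa using hj
          rw [transitionMatrix_apply, if_neg hij, mul_zero]
        · simp
    rw [h1]; linarith
  · cases τ with
    | zero => simpa [influence, Matrix.one_apply] using hn'
    | succ t =>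
      have h : influence G (t + 1) i ≤ ∑ j, influence G t j * (1 / 2) := by
        rw [influence_succ]
        exact Finset.sum_le_sum fun j _ => mul_le_mul_of_nonneg_left
          (transitionMatrix_le_half G hi j) (influence_pos G t j).le
      rw [← Finset.sum_mul, sum_influence] at h
      linarith

/-- The limit of the influences: proportional to the degree, with total `n`. -/
noncomputable def limitInfluence (i : V) : ℝ := Fintype.card V / (2 * numEdges G) * deg G i

theorem numEdges_pos {W : Type*} [Fintype W] [Nonempty W] (H : SimpleGraph W)
    [DecidableRel H.Adj] : 0 < numEdges H := by
  have h : (0 : ℝ) < Fintype.card W := by exact_mod_cast Fintype.card_pos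
  unfold numEdges
  positivity

theorem sum_limitInfluence [Nonempty V] : ∑ i, limitInfluence G i = Fintype.card V := by
  have h := numEdges_pos G
  simp only [limitInfluence]
  rw [← Finset.mul_sum, sum_deg]
  field_simp

theorem tendsto_influence (hG : G.Connected) (i : V) :
    Tendsto (fun τ => influence G τ i) atTop (𝓝 (limitInfluence G i)) := by
  have := hG.nonempty
  have h := tendsto_sum_abs_vecMul_pow (transitionMatrix_mem_rowStochastic G)
    (transitionMatrix_pow_card_pos G hG) (v := (fun _ => 1) - limitInfluence G)
    (by simp [Finset.sum_sub_distrib, sum_limitInfluence])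
  have hlim : ∀ τ, limitInfluence G ᵥ* transitionMatrix G ^ τ = limitInfluence G := fun τ => by
    have : limitInfluence G =
        (Fintype.card V / (2 * numEdges G)) • (fun v => (deg G v : ℝ)) := rfl
    rw [this, smul_vecMul, deg_vecMul_transitionMatrix_pow]
  simp only [sub_vecMul, hlim, ← influence_eq_vecMul] at h
  rw [tendsto_iff_dist_tendsto_zero]
  refine squeeze_zero (fun _ => dist_nonneg) (fun τ => ?_) h
  rw [Real.dist_eq]
  exact Finset.single_le_sum (f := fun i => |(influence G τ - limitInfluence G) i|)
    (fun _ _ => abs_nonneg _) (Finset.mem_univ i)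

theorem tendsto_payoff (hG : G.Connected) (x y : V → ℝ) :
    Tendsto (fun τ => payoff G τ x y) atTop (𝓝 (blotto (limitInfluence G) x y)) := by
  simp only [payoff_eq_blotto]
  exact tendsto_finsetSum _ fun i _ => (tendsto_influence G hG i).mul_const _

theorem longTermPayoff_eq_blotto (hG : G.Connected) :
    longTermPayoff G = blotto (limitInfluence G) := by
  funext x y
  exact (tendsto_payoff G hG x y).limUnder_eq

end Graph

/-! ### Closed polygons with prescribed side lengths -/

section Polygon

/-- Numbers in `[0, c]` have a signed sum in `[-c, c]`.  The signs are encoded by angles, which the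
proof takes to be `0` or `π`. -/
theorem exists_abs_sum_le {ι : Type*} [DecidableEq ι] (a : ι → ℝ) {c : ℝ} (s : Finset ι)
    (ha : ∀ i, 0 ≤ a i) (hac : ∀ i ∈ s, a i ≤ c) (hc : 0 ≤ c) :
    ∃ θ : ι → ℝ, ∃ r : ℝ, ∑ i ∈ s, (a i : ℂ) * Complex.exp (θ i * Complex.I) = r ∧ |r| ≤ c := by
  induction s using Finset.induction_on with
  | empty => exact ⟨0, 0, by simp, by simpa using hc⟩
  | insert j s hj ih =>
    obtain ⟨θ, r, hr, hrc⟩ := ih fun i hi => hac i (Finset.mem_insert_of_mem hi)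
    have hjc := hac j (Finset.mem_insert_self j s)
    have hj0 := ha j
    have hrest : ∀ φ : ℝ, ∑ i ∈ s, (a i : ℂ) *
        Complex.exp ((Function.update θ j φ i : ℝ) * Complex.I) = r := fun φ => by
      rw [← hr]
      refine Finset.sum_congr rfl fun i hi => ?_
      rw [Function.update_of_ne (ne_of_mem_of_not_mem hi hj)]
    rw [abs_le] at hrc
    -- the sign of the new term is opposite to that of the sum so far
    rcases le_total 0 r with h | h
    · refine ⟨Function.update θ j Real.pi, r - a j, ?_, abs_le.2 ⟨by linarith, by linarith⟩⟩
      rw [Finset.sum_insert hj, hrest, Function.update_self, Complex.exp_pi_mul_I]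
      push_cast
      ring
    · refine ⟨Function.update θ j 0, r + a j, ?_, abs_le.2 ⟨by linarith, by linarith⟩⟩
      rw [Finset.sum_insert hj, hrest, Function.update_self]
      push_cast
      simp [add_comm]

/-- Positive numbers, none of which exceeds the sum of the others, are the side lengths of a
closed polygon in the plane: fold the sides other than the longest one onto a line so that their
sum is at most as long as the longest side, then unfold them until the lengths agree. -/
theorem exists_closed_polygon {ι : Type*} [Fintype ι] (a : ι → ℝ) (ha : ∀ i, 0 < a i)
    (hmax : ∀ i, 2 * a i ≤ ∑ j, a j) :
    ∃ u : ι → ℂ, (∀ i, ‖u i‖ = 1) ∧ ∑ i, (a i : ℂ) * u i = 0 := by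
  classical
  rcases isEmpty_or_nonempty ι with hι | hι
  · exact ⟨0, fun i => isEmptyElim i, by simp⟩
  obtain ⟨k, hk⟩ := Finite.exists_max a
  obtain ⟨θ, r, hr, hrk⟩ := exists_abs_sum_le a (Finset.univ.erase k) (fun i => (ha i).le)
    (fun i _ => hk i) (ha k).le
  set w : ℝ → ℂ := fun t =>
    ∑ i ∈ Finset.univ.erase k, (a i : ℂ) * Complex.exp ((t * θ i : ℝ) * Complex.I)
  have hw : Continuous fun t => ‖w t‖ := by fun_prop
  have h0 : a k ≤ ‖w 0‖ := by
    have h1 : w 0 = ((∑ i ∈ Finset.univ.erase k, a i : ℝ) : ℂ) := by simp [w]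
    have h2 := Finset.add_sum_erase Finset.univ a (Finset.mem_univ k)
    rw [h1, Complex.norm_real, Real.norm_eq_abs]
    exact le_trans (by linarith [hmax k]) (le_abs_self _)
  have h1 : ‖w 1‖ ≤ a k := by
    have : w 1 = r := by simp only [w, one_mul]; exact hr
    rwa [this, Complex.norm_real]
  obtain ⟨t, -, ht⟩ := intermediate_value_Icc' zero_le_one hw.continuousOn ⟨h1, h0⟩
  have hak : (a k : ℂ) ≠ 0 := by exact_mod_cast (ha k).ne'
  refine ⟨fun i => if i = k then -w t / a k else Complex.exp ((t * θ i : ℝ) * Complex.I),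
    fun i => ?_, ?_⟩
  · dsimp only
    split_ifs
    · rw [norm_div, norm_neg, Complex.norm_real, Real.norm_eq_abs, abs_of_pos (ha k)]
      exact (div_eq_one_iff_eq (ha k).ne').2 ht
    · exact Complex.norm_exp_ofReal_mul_I _
  · rw [← Finset.add_sum_erase Finset.univ _ (Finset.mem_univ k)]
    have h2 : ∑ i ∈ Finset.univ.erase k, (a i : ℂ) *
        (if i = k then -w t / a k else Complex.exp ((t * θ i : ℝ) * Complex.I)) = w t :=
      Finset.sum_congr rfl fun i hi => by rw [if_neg (Finset.ne_of_mem_erase hi)]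
    beta_reduce
    rw [h2, if_pos rfl, mul_div_cancel₀ _ hak]
    ring

end Polygon

/-! ### A law on the disc with uniform projections -/

section Disc

open Real

/-- The integrand has the primitive `arcsin (y / s) / (2 π)` on `(-s, s)`, and vanishes elsewhere,
because the square root of a non-positive number and the inverse of `0` are `0`. -/
theorem lintegral_inv_sqrt_sq_sub {s : ℝ} (hs : 0 < s) :
    ∫⁻ y : ℝ, ENNReal.ofReal (1 / (2 * π * √(s ^ 2 - y ^ 2))) = ENNReal.ofReal (1 / 2) := by
  have hderiv : ∀ y ∈ Set.Ioo (-s) s, HasDerivAt (fun y => (2 * π)⁻¹ * arcsin (y / s))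
      (1 / (2 * π * √(s ^ 2 - y ^ 2))) y := by
    intro y hy
    have h1 : y / s < 1 := (div_lt_one hs).2 hy.2
    have h2 : -1 < y / s := by rw [lt_div_iff₀ hs]; linarith [hy.1]
    have hsq : √(s ^ 2 - y ^ 2) = s * √(1 - (y / s) ^ 2) := by
      have : s ^ 2 - y ^ 2 = s ^ 2 * (1 - (y / s) ^ 2) := by field_simp
      rw [this, sqrt_mul (sq_nonneg s), sqrt_sq hs.le]
    have h3 := ((hasDerivAt_arcsin h2.ne' h1.ne).comp y ((hasDerivAt_id y).div_const s)).const_mul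
      (2 * π)⁻¹
    refine h3.congr_deriv ?_
    rw [hsq]
    simp only [one_div, mul_inv]
    ring
  have hcont : ContinuousOn (fun y => (2 * π)⁻¹ * arcsin (y / s)) (Set.Icc (-s) s) := by
    fun_prop
  have hnn : ∀ y, 0 ≤ 1 / (2 * π * √(s ^ 2 - y ^ 2)) := fun y => by positivity
  have hint : IntegrableOn (fun y => 1 / (2 * π * √(s ^ 2 - y ^ 2))) (Set.Ioc (-s) s) :=
    intervalIntegral.integrableOn_deriv_of_nonneg hcont hderiv fun y _ => hnn y
  have hle : -s ≤ s := by linarith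
  have hval : ∫ y in (-s)..s, 1 / (2 * π * √(s ^ 2 - y ^ 2)) = 1 / 2 := by
    rw [intervalIntegral.integral_eq_sub_of_hasDerivAt_of_le hle hcont hderiv
      ((intervalIntegrable_iff_integrableOn_Ioc_of_le hle).2 hint)]
    rw [neg_div, div_self hs.ne', arcsin_neg, arcsin_one]
    field_simp
    ring
  have hsupp : ∀ y, y ∉ Set.Ioc (-s) s →
      ENNReal.ofReal (1 / (2 * π * √(s ^ 2 - y ^ 2))) = 0 := by
    intro y hy
    have : s ^ 2 - y ^ 2 ≤ 0 := by
      rw [Set.mem_Ioc, not_and_or, not_lt, not_le] at hy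
      rcases hy with h | h <;> nlinarith
    rw [sqrt_eq_zero_of_nonpos this]
    simp
  have hind : (Set.Ioc (-s) s).indicator
      (fun y => ENNReal.ofReal (1 / (2 * π * √(s ^ 2 - y ^ 2)))) =
      fun y => ENNReal.ofReal (1 / (2 * π * √(s ^ 2 - y ^ 2))) :=
    Set.indicator_eq_self.2 fun y hy => by_contra fun h => hy (hsupp y h)
  rw [← hind, lintegral_indicator measurableSet_Ioc, ← ofReal_integral_eq_lintegral_ofReal hint
    (ae_of_all _ hnn), ← intervalIntegral.integral_of_le hle, hval]

/-- The law on the closed unit disc obtained by projecting the uniform law on the unit sphere of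
`ℝ³`.  Outside the open disc the formula for the density yields `0`, because the square root of a
non-positive number and the inverse of `0` are `0`. -/
noncomputable def discLaw : Measure ℂ :=
  volume.withDensity fun z => ENNReal.ofReal (1 / (2 * π * √(1 - Complex.normSq z)))

theorem measurable_discDensity :
    Measurable fun z : ℂ => ENNReal.ofReal (1 / (2 * π * √(1 - Complex.normSq z))) := by
  have := Complex.continuous_normSq.measurable
  fun_prop

/-- Archimedes' hat-box theorem for the real axis: each vertical chord of the disc carries the same
mass `1 / 2` per unit length of its projection. -/
theorem map_re_discLaw :
    discLaw.map Complex.re = ProbabilityTheory.cond volume (Set.Icc (-1 : ℝ) 1) := by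
  ext S hS
  rw [Measure.map_apply Complex.measurable_re hS, discLaw,
    withDensity_apply _ (Complex.measurable_re hS), ← lintegral_indicator
    (Complex.measurable_re hS),
    ← Complex.volume_preserving_equiv_real_prod.symm.lintegral_comp
      (measurable_discDensity.indicator (Complex.measurable_re hS)), Measure.volume_eq_prod,
    lintegral_prod _ (by exact ((measurable_discDensity.indicator (Complex.measurable_re hS)).comp
      Complex.measurableEquivRealProd.symm.measurable).aemeasurable)]
  have hslice : ∀ x : ℝ, ∫⁻ y : ℝ, (Complex.re ⁻¹' S).indicator
      (fun z : ℂ => ENNReal.ofReal (1 / (2 * π * √(1 - Complex.normSq z))))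
      (Complex.measurableEquivRealProd.symm (x, y)) =
      (S ∩ Set.Ioo (-1) 1).indicator (fun _ => ENNReal.ofReal (1 / 2)) x := by
    intro x
    by_cases hx : x ∈ S
    · have h1 : ∀ y : ℝ, (Complex.re ⁻¹' S).indicator
          (fun z : ℂ => ENNReal.ofReal (1 / (2 * π * √(1 - Complex.normSq z))))
          (Complex.measurableEquivRealProd.symm (x, y)) =
          ENNReal.ofReal (1 / (2 * π * √(1 - x ^ 2 - y ^ 2))) := by
        intro y
        rw [Set.indicator_of_mem (by simpa [Complex.measurableEquivRealProd_symm_apply] using hx)]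
        simp only [Complex.measurableEquivRealProd_symm_apply, Complex.normSq_mk]
        rw [show 1 - (x * x + y * y) = 1 - x ^ 2 - y ^ 2 by ring]
      simp only [h1]
      by_cases hx1 : x ∈ Set.Ioo (-1 : ℝ) 1
      · rw [Set.indicator_of_mem (show x ∈ S ∩ Set.Ioo (-1) 1 from ⟨hx, hx1⟩)]
        have h2 : 0 < 1 - x ^ 2 := by nlinarith [hx1.1, hx1.2]
        rw [← lintegral_inv_sqrt_sq_sub (sqrt_pos.2 h2), sq_sqrt h2.le]
      · rw [Set.indicator_of_notMem fun h => hx1 h.2]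
        have h2 : 1 - x ^ 2 ≤ 0 := by
          rw [Set.mem_Ioo, not_and_or, not_lt, not_lt] at hx1
          rcases hx1 with h | h <;> nlinarith
        have h3 : ∀ y : ℝ, √(1 - x ^ 2 - y ^ 2) = 0 := fun y =>
          sqrt_eq_zero_of_nonpos (by nlinarith [sq_nonneg y])
        simp [h3]
    · rw [Set.indicator_of_notMem fun h => hx h.1]
      simp [Set.indicator, Complex.measurableEquivRealProd_symm_apply, hx]
  simp only [hslice]
  rw [lintegral_indicator (hS.inter measurableSet_Ioo), setLIntegral_const,
    ProbabilityTheory.cond_apply measurableSet_Icc, Real.volume_Icc, Set.inter_comm S,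
    measure_congr (Ioo_ae_eq_Icc.inter (ae_eq_refl S)), one_div,
    ENNReal.ofReal_inv_of_pos two_pos]
  norm_num

/-- The law on the disc is invariant under rotations. -/
theorem map_mul_discLaw {c : ℂ} (hc : ‖c‖ = 1) : discLaw.map (fun z => c * z) = discLaw := by
  let e := rotation ⟨c, mem_sphere_zero_iff_norm.2 hc⟩
  have he : ∀ z, e z = c * z := fun z => rfl
  have hm : MeasurePreserving e volume volume := e.measurePreserving
  have hmul : Measurable fun z => c * z := by fun_prop
  ext S hS
  rw [Measure.map_apply hmul hS, discLaw, withDensity_apply _ hS, withDensity_apply _ (hmul hS),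
    ← hm.setLIntegral_comp_preimage hS measurable_discDensity]
  refine lintegral_congr fun z => ?_
  rw [he, map_mul, Complex.normSq_eq_norm_sq c, hc]
  norm_num

theorem map_re_mul_discLaw {c : ℂ} (hc : ‖c‖ = 1) :
    discLaw.map (fun z => (c * z).re) = ProbabilityTheory.cond volume (Set.Icc (-1 : ℝ) 1) := by
  rw [← map_re_discLaw]
  nth_rewrite 2 [← map_mul_discLaw hc]
  rw [Measure.map_map Complex.measurable_re (by fun_prop)]
  rfl

instance : IsProbabilityMeasure discLaw := by
  have h : IsProbabilityMeasure (discLaw.map Complex.re) := by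
    rw [map_re_discLaw]
    exact ProbabilityTheory.cond_isProbabilityMeasure_of_finite (by norm_num) (by norm_num)
  exact (Measure.isProbabilityMeasure_map_iff Complex.measurable_re.aemeasurable).1 h

theorem map_affine_cond_Icc {L : ℝ} (hL : 0 < L) :
    (ProbabilityTheory.cond volume (Set.Icc (-1 : ℝ) 1)).map (fun r => L / 2 * (1 + r)) =
      ProbabilityTheory.cond volume (Set.Icc 0 L) := by
  have hf : Measurable fun r : ℝ => L / 2 * (1 + r) := by fun_prop
  have hpre : (fun r : ℝ => L / 2 * (1 + r)) ⁻¹' Set.Icc 0 L = Set.Icc (-1) 1 := by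
    ext r
    simp only [Set.mem_preimage, Set.mem_Icc]
    constructor <;> rintro ⟨h1, h2⟩ <;> constructor <;> nlinarith
  ext S hS
  have hvol : volume ((fun r : ℝ => L / 2 * (1 + r)) ⁻¹' (Set.Icc 0 L ∩ S)) =
      ENNReal.ofReal (2 / L) * volume (Set.Icc 0 L ∩ S) := by
    have h1 : (fun r : ℝ => L / 2 * (1 + r)) ⁻¹' (Set.Icc 0 L ∩ S) =
        (fun r => 1 + r) ⁻¹' ((fun r => L / 2 * r) ⁻¹' (Set.Icc 0 L ∩ S)) := rfl
    rw [h1, measure_preimage_add, Real.volume_preimage_mul_left (by positivity), inv_div,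
      abs_of_pos (by positivity)]
  rw [Measure.map_apply hf hS, ProbabilityTheory.cond_apply measurableSet_Icc,
    ProbabilityTheory.cond_apply measurableSet_Icc, ← hpre, ← Set.preimage_inter, hvol, hpre,
    ← mul_assoc, Real.volume_Icc, Real.volume_Icc, ← ENNReal.ofReal_inv_of_pos (by norm_num),
    ← ENNReal.ofReal_inv_of_pos (by linarith), ← ENNReal.ofReal_mul (by norm_num)]
  congr 2
  rw [sub_zero, ← mul_div_assoc, inv_mul_eq_div, ← one_div]
  field_simp
  norm_num

end Disc

/-- Side lengths of a closed polygon of perimeter `2B` are the ranges of uniform random variables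
with constant sum `B`. -/
theorem exists_hasUniformCoordinates {V : Type*} [Fintype V] {B : ℝ} {L : V → ℝ}
    (hL : ∀ i, 0 < L i) (hsum : ∑ i, L i = 2 * B) (hmax : ∀ i, L i ≤ B) :
    ∃ F, HasUniformCoordinates B L F := by
  obtain ⟨u, hu, hu0⟩ := exists_closed_polygon L hL fun i => by rw [hsum]; linarith [hmax i]
  set Φ : ℂ → V → ℝ := fun z i => L i / 2 * (1 + (u i * z).re)
  have hΦ : Measurable Φ := by fun_prop
  have hcoord : ∀ i, pdf.IsUniform (fun x : V → ℝ => x i) (Set.Icc 0 (L i)) (discLaw.map Φ)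
      volume := fun i => by
    rw [pdf.IsUniform, Measure.map_map (measurable_pi_apply i) hΦ, ← map_affine_cond_Icc (hL i),
      ← map_re_mul_discLaw (hu i), Measure.map_map (by fun_prop) (by fun_prop)]
    rfl
  have hprob : IsProbabilityMeasure (discLaw.map Φ) :=
    Measure.isProbabilityMeasure_map hΦ.aemeasurable
  refine ⟨discLaw.map Φ, ⟨hprob, ?_⟩, hcoord⟩
  have hnn : ∀ᵐ x ∂discLaw.map Φ, ∀ v, 0 ≤ x v := by
    refine ae_all_iff.2 fun v => ?_
    have h : ∀ᵐ r ∂(discLaw.map Φ).map (fun x : V → ℝ => x v), 0 ≤ r := by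
      rw [hcoord v]
      filter_upwards [ProbabilityTheory.ae_cond_mem measurableSet_Icc] with r hr using hr.1
    exact ae_of_ae_map (measurable_pi_apply v).aemeasurable h
  have hB : ∀ᵐ x ∂discLaw.map Φ, ∑ v, x v = B := by
    rw [ae_map_iff hΦ.aemeasurable (measurableSet_eq_fun (by fun_prop) measurable_const)]
    refine ae_of_all _ fun z => ?_
    have h1 : ∑ v, L v * (u v * z).re = 0 := by
      have h := congrArg (fun w : ℂ => (w * z).re) hu0
      simp only [Finset.sum_mul, Complex.re_sum, mul_assoc, Complex.re_ofReal_mul, zero_mul,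
        Complex.zero_re] at h
      exact h
    have h2 : ∀ v, Φ z v = L v / 2 + L v * (u v * z).re / 2 := fun v => by simp only [Φ]; ring
    simp only [h2]
    rw [Finset.sum_add_distrib, ← Finset.sum_div, ← Finset.sum_div, h1, hsum]
    ring
  filter_upwards [hnn, hB] with x h1 h2 using ⟨h1, h2⟩

/-! ### Equilibria of Colonel Blotto games -/

section Equilibrium

variable {V : Type*} [Fintype V]

theorem measurable_realSign : Measurable Real.sign :=
  Measurable.ite measurableSet_Iio measurable_const
    (Measurable.ite measurableSet_Ioi measurable_const measurable_const)

theorem abs_realSign_le (r : ℝ) : |Real.sign r| ≤ 1 := by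
  rcases Real.sign_apply_eq r with h | h | h <;> simp [h]

theorem blotto_swap (p x y : V → ℝ) : blotto p y x = -blotto p x y := by
  simp only [blotto, ← Finset.sum_neg_distrib, ← mul_neg, ← Real.sign_neg, neg_sub]

theorem integrable_blotto (p : V → ℝ) (μ : Measure ((V → ℝ) × (V → ℝ))) [IsFiniteMeasure μ] :
    Integrable (Function.uncurry (blotto p)) μ := by
  refine integrable_finsetSum _ fun i _ => Integrable.const_mul ?_ _
  refine Integrable.of_bound (C := 1) ?_ (ae_of_all _ fun z => abs_realSign_le _)
  exact (measurable_realSign.comp (by fun_prop)).aestronglyMeasurable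

theorem integrable_realSign_sub {ι : Type*} (F : Measure (ι → ℝ)) [IsFiniteMeasure F]
    (r : ℝ) (i : ι) :
    Integrable (fun y : ι → ℝ => Real.sign (r - y i)) F :=
  Integrable.of_bound (C := 1)
    (measurable_realSign.comp (by fun_prop)).aestronglyMeasurable
    (ae_of_all _ fun _ => abs_realSign_le _)

theorem mixedPayoff_blotto_swap (p : V → ℝ) (F H : Measure (V → ℝ)) [IsFiniteMeasure F]
    [IsFiniteMeasure H] :
    mixedPayoff (blotto p) H F = -mixedPayoff (blotto p) F H := by
  rw [mixedPayoff, mixedPayoff, integral_integral_swap (integrable_blotto p _)]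
  simp only [← integral_neg, ← blotto_swap]

/-- An amount `r` beats a uniform amount on `[0, L]` with probability at most `r / L`. -/
theorem integral_realSign_le {ι : Type*} {F : Measure (ι → ℝ)} [IsProbabilityMeasure F]
    {i : ι} {L r : ℝ}
    (hL : 0 < L) (hF : pdf.IsUniform (fun y : ι → ℝ => y i) (Set.Icc 0 L) F volume)
    (hr : 0 ≤ r) : ∫ y, Real.sign (r - y i) ∂F ≤ 2 * (r / L) - 1 := by
  set S : Set (ι → ℝ) := (fun y : ι → ℝ => y i) ⁻¹' Set.Iic r
  have hS : MeasurableSet S := measurable_pi_apply i measurableSet_Iic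
  have hFS : F.real S ≤ r / L := by
    rw [Measure.real, ← Measure.map_apply (measurable_pi_apply i) measurableSet_Iic, hF,
      ProbabilityTheory.cond_apply measurableSet_Icc, Real.volume_Icc, sub_zero]
    have hsub : Set.Icc 0 L ∩ Set.Iic r ⊆ Set.Icc 0 r := fun y hy => ⟨hy.1.1, hy.2⟩
    have hvol : volume (Set.Icc 0 L ∩ Set.Iic r) ≤ ENNReal.ofReal r := by
      simpa using measure_mono (μ := volume) hsub
    rw [ENNReal.toReal_mul, ENNReal.toReal_inv, ENNReal.toReal_ofReal hL.le, div_eq_inv_mul]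
    exact mul_le_mul_of_nonneg_left (ENNReal.toReal_le_of_le_ofReal hr hvol) (by positivity)
  have hle : ∀ y : ι → ℝ, Real.sign (r - y i) ≤ 2 * S.indicator (fun _ => (1 : ℝ)) y - 1 := by
    intro y
    by_cases hy : y ∈ S
    · rw [Set.indicator_of_mem hy]
      linarith [(abs_le.1 (abs_realSign_le (r - y i))).2]
    · rw [Set.indicator_of_notMem hy, Real.sign_of_neg (sub_neg.2 (not_le.1 hy))]
      norm_num
  have hind : Integrable (S.indicator fun _ => (1 : ℝ)) F := (integrable_const 1).indicator hS
  have h := integral_mono (integrable_realSign_sub F r i)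
    ((hind.const_mul 2).sub (integrable_const 1)) hle
  simp only [Pi.sub_apply] at h
  rw [integral_sub (hind.const_mul 2) (integrable_const 1), integral_const_mul,
    integral_indicator_const _ hS, smul_eq_mul, mul_one] at h
  simp only [integral_const, probReal_univ, one_smul] at h
  linarith

variable {p L : V → ℝ} {B : ℝ} {F : Measure (V → ℝ)}

/-- No allocation within the budget wins, on average, against a law with uniform coordinates on
intervals proportional to the values of the nodes. -/
theorem integral_blotto_nonpos [Nonempty V] (hB : 0 < B) (hp : ∀ i, 0 < p i)
    (hL : ∀ i, L i = 2 * B * (p i / ∑ j, p j)) (hF : HasUniformCoordinates B L F)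
    {x : V → ℝ} (hx : x ∈ budgetAlloc B) : ∫ y, blotto p x y ∂F ≤ 0 := by
  have := hF.1.1
  have hS : 0 < ∑ j, p j := Finset.sum_pos (fun i _ => hp i) Finset.univ_nonempty
  set S := ∑ j, p j with hSdef
  have hL0 : ∀ i, 0 < L i := fun i => by
    have := hp i
    rw [hL]; positivity
  simp only [blotto]
  rw [integral_finsetSum _ fun i _ => (integrable_realSign_sub F (x i) i).const_mul _]
  calc ∑ i, ∫ y, p i * Real.sign (x i - y i) ∂F
      ≤ ∑ i, (S / B * x i - p i) := by
        refine Finset.sum_le_sum fun i _ => ?_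
        rw [integral_const_mul]
        refine (mul_le_mul_of_nonneg_left
          (integral_realSign_le (hL0 i) (hF.2 i) (hx.1 i)) (hp i).le).trans_eq ?_
        rw [hL]
        have := (hp i).ne'
        field_simp
    _ = S / B * ∑ i, x i - S := by rw [Finset.sum_sub_distrib, Finset.mul_sum]
    _ ≤ S / B * B - S := by
        have := hx.2
        gcongr
    _ = 0 := by field_simp; ring

theorem isNashEquilibrium_blotto [Nonempty V] {A : Set (V → ℝ)} (hB : 0 < B)
    (hp : ∀ i, 0 < p i) (hL : ∀ i, L i = 2 * B * (p i / ∑ j, p j))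
    (hF : HasUniformCoordinates B L F) (hA : simplexAlloc B ⊆ A) (hA' : A ⊆ budgetAlloc B) :
    IsNashEquilibrium A (blotto p) F F := by
  have := hF.1.1
  have hmix : IsMixedStrategy A F := ⟨hF.1.1, hF.1.2.mono fun x hx => hA hx⟩
  have hzero : mixedPayoff (blotto p) F F = 0 := by
    linarith [mixedPayoff_blotto_swap p F F]
  have hle : ∀ F', IsMixedStrategy A F' → mixedPayoff (blotto p) F' F ≤ 0 := fun F' hF' =>
    integral_nonpos_of_ae <| hF'.2.mono fun x hx =>
      integral_blotto_nonpos hB hp hL hF (hA' hx)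
  refine ⟨hmix, hmix, fun F' hF' => hzero ▸ hle F' hF', fun H' hH' => ?_⟩
  have := hH'.1
  rw [hzero, neg_zero, ← mixedPayoff_blotto_swap]
  exact hle H' hH'

end Equilibrium

/-! ### Solution of the game -/

/-- The ranges of the uniform coordinates satisfy the polygon inequality exactly when no node
carries more than half of the total value. -/
theorem solvedByUniform_blotto {V : Type*} [Fintype V] [Nonempty V] {p L : V → ℝ} {B : ℝ}
    (hB : 0 < B) (hp : ∀ i, 0 < p i) (hhalf : ∀ i, 2 * p i ≤ ∑ j, p j)
    (hL : ∀ i, L i = 2 * B * (p i / ∑ j, p j)) : SolvedByUniform (blotto p) B L := by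
  have hS : 0 < ∑ j, p j := Finset.sum_pos (fun i _ => hp i) Finset.univ_nonempty
  refine ⟨exists_hasUniformCoordinates (fun i => ?_) ?_ fun i => ?_, fun F hF => ⟨?_, ?_⟩⟩
  · have := hp i
    rw [hL]; positivity
  · simp only [hL]
    rw [← Finset.mul_sum, ← Finset.sum_div, div_self hS.ne', mul_one]
  · have : L i = B * (2 * p i / ∑ j, p j) := by rw [hL]; ring
    rw [this]
    exact mul_le_of_le_one_right hB.le ((div_le_one hS).2 (hhalf i))
  · exact isNashEquilibrium_blotto hB hp hL hF subset_rfl fun x hx => ⟨hx.1, hx.2.le⟩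
  · exact isNashEquilibrium_blotto hB hp hL hF (fun x hx => ⟨hx.1, hx.2.le⟩) subset_rfl

end VoterGame

theorem theorem2 {V : Type*} [Fintype V] [DecidableEq V] (G : SimpleGraph V) [DecidableRel G.Adj]
    (hn : 2 ≤ Fintype.card V) (B : ℝ) (hB : 0 < B) :
    (∀ τ : ℕ, VoterGame.SolvedByUniform (VoterGame.payoff G τ) B
      (fun i => 2 * B * ((1 / (Fintype.card V : ℝ)) *
        ∑ j, (VoterGame.transitionMatrix G ^ τ) j i))) ∧
    (G.Connected →
      (∀ x y : V → ℝ, Tendsto (fun τ => VoterGame.payoff G τ x y) atTop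
        (𝓝 (VoterGame.longTermPayoff G x y))) ∧
      VoterGame.SolvedByUniform (VoterGame.longTermPayoff G) B
        (fun i => B * (VoterGame.deg G i : ℝ) / VoterGame.numEdges G)) := by
  open VoterGame in
  have hne : Nonempty V := Fintype.card_pos_iff.1 (by omega)
  have hcard : (0 : ℝ) < Fintype.card V := by exact_mod_cast Fintype.card_pos
  refine ⟨fun τ => ?_, fun hG => ⟨fun x y => ?_, ?_⟩⟩
  · rw [payoff_eq_blotto]
    refine solvedByUniform_blotto hB (influence_pos G τ) (fun i => ?_) fun i => ?_
    · rw [sum_influence]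
      exact two_mul_influence_le G hn τ i
    · rw [sum_influence, influence, one_div_mul_eq_div]
  · rw [longTermPayoff_eq_blotto G hG]
    exact tendsto_payoff G hG x y
  · rw [longTermPayoff_eq_blotto G hG]
    have hE := numEdges_pos G
    refine solvedByUniform_blotto hB (fun i => ?_) (fun i => ?_) fun i => ?_
    · have : (0 : ℝ) < deg G i := by exact_mod_cast deg_pos G i
      unfold limitInfluence
      positivity
    · -- the bound on the influences passes to the limit
      rw [sum_limitInfluence]
      exact le_of_tendsto' ((tendsto_influence G hG i).const_mul 2) fun τ =>
        two_mul_influence_le G hn τ i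
    · rw [sum_limitInfluence, limitInfluence]
      field_simp
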